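/- For $0\le x<1$ let $$K(x)=\int_0^1\frac{dt}{\sqrt{(1-t^2)(1-x^2t^2)}}$$ be the complete Legendre elliptic integral of the first kind. Define $$L_0(x)=\frac{1}{\sqrt{2(x+1)}}\ln\frac{2\sqrt{2(x+1)}+x+3}{1-x},\qquad G_0(x)=\frac{1}{\sqrt{2x(x+1)}}\ln\frac{2\sqrt{2x(x+1)}+3x+1}{1-x},$$ where $G_0(0)$ is understood as the limit $G_0(0)=\lim_{x\to0+}G_0(x)=2$, $$L_1(x)=\frac{2}{\sqrt{(x+3)(3x+1)}}\ln\frac{\sqrt{(x+3)(3x+1)}+2x+2}{1-x},\qquad G_1(x)=\frac12\bigl[G_0(x)+L_0(x)\bigr],$$ $$G_2(x)=\frac25\left[L_0(x)+G_0(x)+\frac{1}{\sqrt{(x+3)(3x+1)}}\ln\frac{\sqrt{(x+3)(3x+1)}+2x+2}{1-x}\right],$$ $$L_2(x)=\frac52\left[\frac{\frac{\sqrt5+1}{2\sqrt5}}{R_+(x)}\ln\frac{2R_+(x)+\frac{9+\sqrt5}{2}x+\frac{11+3\sqrt5}{2}}{\frac{5+\sqrt5}{2}(1-x)} +\frac{\frac{\sqrt5-1}{2\sqrt5}}{R_-(x)}\ln\frac{2R_-(x)+\frac{9-\sqrt5}{2}x+\frac{11-3\sqrt5}{2}}{\frac{5-\sqrt5}{2}(1-x)}\right],$$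 where $$R_\pm(x)=\sqrt{(x+4\pm\sqrt5)\left(\tfrac{7\pm\sqrt5}{2}x+\tfrac{3\pm\sqrt5}{2}\right)}.$$ Then for every $x$ with $0\le x<1$ $$L_0(x)\le L_1(x)\le L_2(x)\le K(x)\le G_2(x)\le G_1(x)\le G_0(x).$$ -/

import Mathlib

noncomputable section

/-- The complete Legendre elliptic integral of the first kind, as a function of the modulus `x`
(used for `0 ≤ x < 1`). -/
def ellipticK (x : ℝ) : ℝ :=
  ∫ t in (0 : ℝ)..1, 1 / √((1 - t ^ 2) * (1 - x ^ 2 * t ^ 2))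

/-- The lower bound `L₀`. -/
def lowerL0 (x : ℝ) : ℝ :=
  1 / √(2 * (x + 1)) * Real.log ((2 * √(2 * (x + 1)) + x + 3) / (1 - x))

/-- The upper bound `G₀`. The formula has a removable singularity at `x = 0`, where the
value is the limit `2` of the formula as `x → 0+`. -/
def upperG0 (x : ℝ) : ℝ :=
  if x = 0 then 2
  else 1 / √(2 * x * (x + 1)) *
    Real.log ((2 * √(2 * x * (x + 1)) + 3 * x + 1) / (1 - x))

/-- The lower bound `L₁`. -/
def lowerL1 (x : ℝ) : ℝ :=
  2 / √((x + 3) * (3 * x + 1)) *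
    Real.log ((√((x + 3) * (3 * x + 1)) + 2 * x + 2) / (1 - x))

/-- The upper bound `G₁`, the arithmetic mean of `G₀` and `L₀`. -/
def upperG1 (x : ℝ) : ℝ :=
  1 / 2 * (upperG0 x + lowerL0 x)

/-- The lower bound `L₂`. -/
def lowerL2 (x : ℝ) : ℝ :=
  5 / 2 *
    (((√5 + 1) / (2 * √5)) /
        √((x + 4 + √5) * ((7 + √5) / 2 * x + (3 + √5) / 2)) *
      Real.log
        ((2 * √((x + 4 + √5) * ((7 + √5) / 2 * x + (3 + √5) / 2))
            + (9 + √5) / 2 * x + (11 + 3 * √5) / 2)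
          / ((5 + √5) / 2 * (1 - x)))
    + ((√5 - 1) / (2 * √5)) /
        √((x + 4 - √5) * ((7 - √5) / 2 * x + (3 - √5) / 2)) *
      Real.log
        ((2 * √((x + 4 - √5) * ((7 - √5) / 2 * x + (3 - √5) / 2))
            + (9 - √5) / 2 * x + (11 - 3 * √5) / 2)
          / ((5 - √5) / 2 * (1 - x))))

/-- The upper bound `G₂`. -/
def upperG2 (x : ℝ) : ℝ :=
  2 / 5 *
    (lowerL0 x + upperG0 x
      + 1 / √((x + 3) * (3 * x + 1)) *
          Real.log ((√((x + 3) * (3 * x + 1)) + 2 * x + 2) / (1 - x)))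

end

/-! Put `A = 1 + x t` and `B = 1 + t`. The integrand of `K` is `1 / √((1 - t) (1 - x t))` times `1 /
√(A B)`. Each bound in the chain replaces `1 / √(A B)` by a weighted mean of reciprocals of points
of the segment from `A` to `B`; such a point has the form `1 + s t`, so the bound is a combination
of integrals of `ellKernel`, which `ellKernel_integral` evaluates by logarithms.

The theorem thus reduces to pointwise inequalities. Those next to `K` are `mean_inv_le_inv_sqrt` and
`inv_sqrt_le_mean_inv`; the others follow from `A ≤ B` and convexity of the reciprocal
(`one_div_half_add_le`). -/

/-- The integrand `1 / (√((1 - t) (1 - x t)) (1 + s t))`, elementarily integrable on `[0, 1]`. -/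
noncomputable def ellKernel (x s t : ℝ) : ℝ := 1 / (√((1 - t) * (1 - x * t)) * (1 + s * t))

/-- The substitution `w = √((1 - t) / (1 - x t))` for integrals of `ellKernel`. -/
lemma ellKernel_integral_of_primitive {x s : ℝ} (hx0 : 0 ≤ x) (hx1 : x < 1) (hs : 0 ≤ s)
    {Φ : ℝ → ℝ}
    (hΦ : ∀ w ∈ Set.Icc (0 : ℝ) 1, HasDerivAt Φ (2 / ((1 + s) - (x + s) * w ^ 2)) w) :
    IntervalIntegrable (ellKernel x s) MeasureTheory.volume 0 1 ∧
      ∫ t in (0 : ℝ)..1, ellKernel x s t = Φ 1 - Φ 0 := by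
  have hpos : ∀ t ∈ Set.Icc (0 : ℝ) 1, 0 < 1 - x * t := fun t ht => by nlinarith [ht.1, ht.2]
  have hmem : ∀ t ∈ Set.Icc (0 : ℝ) 1, √((1 - t) / (1 - x * t)) ∈ Set.Icc (0 : ℝ) 1 := by
    intro t ht
    refine ⟨Real.sqrt_nonneg _, Real.sqrt_le_one.mpr ?_⟩
    rw [div_le_one (hpos t ht)]
    nlinarith [ht.1, ht.2]
  have hcont : ContinuousOn (fun t => -Φ √((1 - t) / (1 - x * t))) (Set.Icc 0 1) := by
    refine ContinuousOn.neg ?_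
    have h1 : ContinuousOn Φ (Set.Icc 0 1) :=
      fun w hw => (hΦ w hw).continuousAt.continuousWithinAt
    refine h1.comp (Real.continuous_sqrt.comp_continuousOn ?_) hmem
    exact ContinuousOn.div (by fun_prop) (by fun_prop) (fun t ht => (hpos t ht).ne')
  have hderiv : ∀ t ∈ Set.Ioo (0 : ℝ) 1,
      HasDerivAt (fun t => -Φ √((1 - t) / (1 - x * t))) (ellKernel x s t) t := by
    intro t ht
    have htI := Set.Ioo_subset_Icc_self ht
    have hp := hpos t htI
    have h1t : 0 < 1 - t := by linarith [ht.2]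
    have hq : 0 < (1 - t) / (1 - x * t) := div_pos h1t hp
    have hden : 0 < 1 + s * t := by nlinarith [ht.1]
    have hd : HasDerivAt (fun t => (1 - t) / (1 - x * t))
        ((-1 * (1 - x * t) - (1 - t) * (-(x * 1))) / (1 - x * t) ^ 2) t :=
      ((hasDerivAt_id t).const_sub 1).div (((hasDerivAt_id t).const_mul x).const_sub 1) hp.ne'
    have h := ((hΦ _ (hmem t htI)).comp t (hd.sqrt hq.ne')).neg
    refine h.congr_deriv ?_
    have hw0 : 0 < √((1 - t) / (1 - x * t)) := Real.sqrt_pos.mpr hq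
    have hw2 : √((1 - t) / (1 - x * t)) ^ 2 = (1 - t) / (1 - x * t) := Real.sq_sqrt hq.le
    have hmul : √((1 - t) * (1 - x * t)) = (1 - x * t) * √((1 - t) / (1 - x * t)) := by
      rw [Real.sqrt_eq_iff_mul_self_eq_of_pos (by positivity)]
      calc _ = (1 - x * t) ^ 2 * √((1 - t) / (1 - x * t)) ^ 2 := by ring
        _ = _ := by rw [hw2]; field_simp
    have hE : (1 + s) - (x + s) * ((1 - t) / (1 - x * t))
        = (1 - x) * (1 + s * t) / (1 - x * t) := by
      field_simp; ring
    have hx : 1 - x ≠ 0 := by linarith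
    rw [ellKernel, hmul, hw2, hE]
    generalize √((1 - t) / (1 - x * t)) = w at hw0
    field_simp
    ring
  have hnonneg : ∀ t ∈ Set.Ioo (0 : ℝ) 1, 0 ≤ ellKernel x s t := by
    intro t ht
    have : 0 ≤ 1 + s * t := by nlinarith [ht.1]
    unfold ellKernel
    positivity
  -- The integrand may blow up at `t = 1`; a nonnegative derivative of a function continuous up to
  -- the endpoints is integrable.
  have hint : IntervalIntegrable (ellKernel x s) MeasureTheory.volume 0 1 :=
    intervalIntegral.intervalIntegrable_deriv_of_nonneg
      (by rwa [Set.uIcc_of_le zero_le_one]) (by simpa using hderiv) (by simpa using hnonneg)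
  refine ⟨hint, ?_⟩
  rw [intervalIntegral.integral_eq_sub_of_hasDerivAt_of_le zero_le_one hcont hderiv hint]
  simp [sub_eq_add_neg, add_comm]

/-- With `a² = 1 + s` and `b² = x + s`, the substituted integrand `2 / (a² - b² w²)` splits into
partial fractions. Positivity of `x + s` is needed to divide by `b`. -/
lemma ellKernel_integral {x s : ℝ} (hx0 : 0 ≤ x) (hx1 : x < 1) (hs : 0 ≤ s) (hxs : 0 < x + s) :
    IntervalIntegrable (ellKernel x s) MeasureTheory.volume 0 1 ∧
      ∫ t in (0 : ℝ)..1, ellKernel x s t = 1 / √((s + x) * (s + 1)) *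
        Real.log ((2 * √((s + x) * (s + 1)) + (2 * s + 1 + x)) / (1 - x)) := by
  obtain ⟨a, ha, ha2⟩ : ∃ a : ℝ, 0 < a ∧ a ^ 2 = 1 + s :=
    ⟨√(1 + s), by positivity, Real.sq_sqrt (by positivity)⟩
  obtain ⟨b, hb, hb2⟩ : ∃ b : ℝ, 0 < b ∧ b ^ 2 = x + s :=
    ⟨√(x + s), by positivity, Real.sq_sqrt hxs.le⟩
  have hab : b < a := lt_of_pow_lt_pow_left₀ 2 ha.le (by linarith)
  have hr : √((s + x) * (s + 1)) = a * b := by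
    rw [Real.sqrt_eq_iff_mul_self_eq_of_pos (by positivity)]
    linear_combination b ^ 2 * ha2 + (1 + s) * hb2
  have key := ellKernel_integral_of_primitive hx0 hx1 hs
    (Φ := fun w => 1 / (a * b) * (Real.log (a + b * w) - Real.log (a - b * w))) (by
      intro w hw
      have h1 : 0 < a + b * w := by nlinarith [hw.1]
      have h2 : 0 < a - b * w := by nlinarith [hw.2]
      have hd1 : HasDerivAt (fun w => a + b * w) (b * 1) w :=
        ((hasDerivAt_id w).const_mul b).const_add a
      have hd2 : HasDerivAt (fun w => a - b * w) (-(b * 1)) w :=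
        ((hasDerivAt_id w).const_mul b).const_sub a
      refine (((hd1.log h1.ne').sub (hd2.log h2.ne')).const_mul _).congr_deriv ?_
      rw [← ha2, ← hb2, show a ^ 2 - b ^ 2 * w ^ 2 = (a + b * w) * (a - b * w) by ring]
      field_simp
      ring)
  refine ⟨key.1, key.2.trans ?_⟩
  have h1 : 0 < a - b := by linarith
  have h2 : 1 - x = (a - b) * (a + b) := by linear_combination hb2 - ha2
  have h3 : 2 * (a * b) + (2 * s + 1 + x) = (a + b) * (a + b) := by
    linear_combination -ha2 - hb2
  rw [hr, h2, h3, mul_div_mul_right _ _ (by positivity), Real.log_div (by positivity) h1.ne']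
  simp

/-! ### The bounds as kernel integrals -/

lemma lowerL0_eq {x : ℝ} (hx0 : 0 ≤ x) (hx1 : x < 1) :
    lowerL0 x = ∫ t in (0 : ℝ)..1, ellKernel x 1 t := by
  rw [(ellKernel_integral hx0 hx1 zero_le_one (by linarith)).2, lowerL0]
  ring_nf

lemma upperG0_eq {x : ℝ} (hx0 : 0 ≤ x) (hx1 : x < 1) :
    IntervalIntegrable (ellKernel x x) MeasureTheory.volume 0 1 ∧
      upperG0 x = ∫ t in (0 : ℝ)..1, ellKernel x x t := by
  rcases hx0.eq_or_lt with rfl | hx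
  -- For `x = s = 0` the substituted integrand is the constant `2`, so the primitive is linear
  -- instead of logarithmic.
  · have key := ellKernel_integral_of_primitive (x := 0) (s := 0) le_rfl hx1 le_rfl
      (Φ := fun w => 2 * w) (fun w _ => by simpa using (hasDerivAt_id w).const_mul 2)
    exact ⟨key.1, by rw [key.2]; simp [upperG0]⟩
  · have key := ellKernel_integral hx0 hx1 hx0 (by linarith)
    refine ⟨key.1, ?_⟩
    rw [key.2, upperG0, if_neg hx.ne']
    ring_nf

lemma lowerL1_eq {x : ℝ} (hx0 : 0 ≤ x) (hx1 : x < 1) :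
    lowerL1 x = ∫ t in (0 : ℝ)..1, ellKernel x ((1 + x) / 2) t := by
  have hr : √((x + 3) * (3 * x + 1)) = 2 * √(((1 + x) / 2 + x) * ((1 + x) / 2 + 1)) := by
    rw [Real.sqrt_eq_iff_mul_self_eq_of_pos (by positivity)]
    linear_combination 4 * Real.mul_self_sqrt
      (show 0 ≤ ((1 + x) / 2 + x) * ((1 + x) / 2 + 1) by positivity)
  rw [(ellKernel_integral hx0 hx1 (by positivity) (by positivity)).2, lowerL1, hr]
  congr 1
  · field_simp
  · ring_nf

/-- One summand of `lowerL2`; the two values `e = ±√5` give the two summands. -/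
lemma lowerL2_summand_eq {x e : ℝ} (hx0 : 0 ≤ x) (hx1 : x < 1) (he : e ^ 2 = 5) (he3 : -3 < e) :
    5 / 2 * (((e + 1) / (2 * e)) / √((x + 4 + e) * ((7 + e) / 2 * x + (3 + e) / 2)) *
      Real.log ((2 * √((x + 4 + e) * ((7 + e) / 2 * x + (3 + e) / 2))
            + (9 + e) / 2 * x + (11 + 3 * e) / 2) / ((5 + e) / 2 * (1 - x))))
    = 1 / 2 * (1 / √(((1 + x) / 2 + (1 - x) * e / 10 + x) * ((1 + x) / 2 + (1 - x) * e / 10 + 1)) *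
        Real.log ((2 * √(((1 + x) / 2 + (1 - x) * e / 10 + x) *
            ((1 + x) / 2 + (1 - x) * e / 10 + 1))
          + (2 * ((1 + x) / 2 + (1 - x) * e / 10) + 1 + x)) / (1 - x))) := by
  have hs : 0 < (1 + x) / 2 + (1 - x) * e / 10 := by nlinarith
  have h5 : 0 < 5 + e := by linarith
  have he0 : e ≠ 0 := by rintro rfl; norm_num at he
  set s := (1 + x) / 2 + (1 - x) * e / 10 with hsdef
  -- Both radicand factors are `(5 + e) / 2` times `s + 1` and `s + x`, by `e² = 5`; the same factor
  -- then cancels inside the logarithm.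
  have hr : √((x + 4 + e) * ((7 + e) / 2 * x + (3 + e) / 2))
      = (5 + e) / 2 * √((s + x) * (s + 1)) := by
    rw [Real.sqrt_eq_iff_mul_self_eq_of_pos (by positivity)]
    have h := Real.mul_self_sqrt (show 0 ≤ (s + x) * (s + 1) by positivity)
    have e1 : (5 + e) / 2 * (s + x) = (7 + e) / 2 * x + (3 + e) / 2 := by
      rw [hsdef]; linear_combination (1 - x) / 20 * he
    have e2 : (5 + e) / 2 * (s + 1) = x + 4 + e := by
      rw [hsdef]; linear_combination (1 - x) / 20 * he
    calc _ = ((5 + e) / 2) ^ 2 * (√((s + x) * (s + 1)) * √((s + x) * (s + 1))) := by ring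
      _ = ((5 + e) / 2 * (s + 1)) * ((5 + e) / 2 * (s + x)) := by rw [h]; ring
      _ = _ := by rw [e1, e2]
  have hR : 0 < √((s + x) * (s + 1)) := by positivity
  have hnum : 2 * ((5 + e) / 2 * √((s + x) * (s + 1))) + (9 + e) / 2 * x + (11 + 3 * e) / 2
      = (5 + e) / 2 * (2 * √((s + x) * (s + 1)) + (2 * s + 1 + x)) := by
    have : (5 + e) / 2 * (2 * s + 1 + x) = (9 + e) / 2 * x + (11 + 3 * e) / 2 := by
      rw [hsdef]; linear_combination (1 - x) / 10 * he
    linear_combination -this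
  rw [hr, hnum, mul_div_mul_left _ _ (by positivity), ← mul_assoc, ← mul_assoc]
  congr 1
  field_simp
  linear_combination -he

lemma sqrt_five_mem : (2 : ℝ) < √5 ∧ √5 < (3 : ℝ) :=
  ⟨Real.lt_sqrt_of_sq_lt (by norm_num), (Real.sqrt_lt' (by norm_num)).mpr (by norm_num)⟩

lemma lowerL2_eq {x : ℝ} (hx0 : 0 ≤ x) (hx1 : x < 1) :
    lowerL2 x = 1 / 2 * (∫ t in (0 : ℝ)..1, ellKernel x ((1 + x) / 2 + (1 - x) * √5 / 10) t)
      + 1 / 2 * ∫ t in (0 : ℝ)..1, ellKernel x ((1 + x) / 2 + (1 - x) * (-√5) / 10) t := by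
  obtain ⟨h2, h3⟩ := sqrt_five_mem
  have h5 : √5 ^ 2 = (5 : ℝ) := Real.sq_sqrt (by norm_num)
  have hp : 0 < (1 + x) / 2 + (1 - x) * √5 / 10 := by nlinarith
  have hm : 0 < (1 + x) / 2 + (1 - x) * (-√5) / 10 := by nlinarith
  rw [(ellKernel_integral hx0 hx1 hp.le (by linarith)).2,
    (ellKernel_integral hx0 hx1 hm.le (by linarith)).2,
    ← lowerL2_summand_eq hx0 hx1 h5 (by linarith),
    ← lowerL2_summand_eq hx0 hx1 (e := -√5) (by rw [neg_sq, h5]) (by linarith), ← mul_add, lowerL2]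
  have hc : (-√5 + 1) / (2 * -√5) = (√5 - 1) / (2 * √5) := by
    field_simp; ring
  rw [hc]
  ring_nf

/-! ### Pointwise comparison of the integrands -/

lemma integrand_factor {x t : ℝ} (hx0 : 0 ≤ x) (hx1 : x < 1) (ht : t ∈ Set.Icc (0 : ℝ) 1) :
    1 / √((1 - t ^ 2) * (1 - x ^ 2 * t ^ 2))
      = 1 / √((1 - t) * (1 - x * t)) * (1 / √((1 + t) * (1 + x * t))) := by
  have : 0 ≤ (1 - t) * (1 - x * t) :=
    mul_nonneg (by linarith [ht.2]) (by nlinarith [ht.1, ht.2])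
  rw [one_div_mul_one_div, ← Real.sqrt_mul this]
  ring_nf

/-- The integrand of `ellipticK` is dominated by `ellKernel x x`. -/
lemma ellipticK_integrable {x : ℝ} (hx0 : 0 ≤ x) (hx1 : x < 1) :
    IntervalIntegrable (fun t => 1 / √((1 - t ^ 2) * (1 - x ^ 2 * t ^ 2)))
      MeasureTheory.volume 0 1 := by
  refine (upperG0_eq hx0 hx1).1.mono_fun
    (by fun_prop : Measurable fun t : ℝ =>
      1 / √((1 - t ^ 2) * (1 - x ^ 2 * t ^ 2))).aestronglyMeasurable ?_
  refine (MeasureTheory.ae_restrict_mem measurableSet_uIoc).mono fun t ht => ?_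
  rw [Set.uIoc_of_le zero_le_one] at ht
  have h1 : 0 < 1 + x * t := by nlinarith [ht.1]
  have h2 : (1 + x * t) ≤ √((1 + t) * (1 + x * t)) := by
    refine Real.le_sqrt_of_sq_le ?_
    nlinarith [ht.1, mul_nonneg (mul_nonneg (sub_nonneg.mpr hx1.le) ht.1.le) h1.le]
  beta_reduce
  rw [integrand_factor hx0 hx1 (Set.Ioc_subset_Icc_self ht), ellKernel,
    Real.norm_of_nonneg (by positivity), Real.norm_of_nonneg (by positivity),
    ← one_div_mul_one_div]
  gcongr

lemma mean_inv_le_inv_sqrt {A B : ℝ} (hA : 0 < A) (hB : 0 < B) :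
    1 / 2 * (1 / ((A + B) / 2 + (B - A) * √5 / 10))
      + 1 / 2 * (1 / ((A + B) / 2 + (B - A) * (-√5) / 10)) ≤ 1 / √(A * B) := by
  obtain ⟨h2, h3⟩ := sqrt_five_mem
  have h5 : √5 ^ 2 = (5 : ℝ) := Real.sq_sqrt (by norm_num)
  have hp : 0 < (A + B) / 2 + (B - A) * √5 / 10 := by nlinarith
  have hm : 0 < (A + B) / 2 + (B - A) * (-√5) / 10 := by nlinarith
  have hM : 0 < A ^ 2 + 3 * (A * B) + B ^ 2 := by positivity
  have heq : 1 / 2 * (1 / ((A + B) / 2 + (B - A) * √5 / 10))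
      + 1 / 2 * (1 / ((A + B) / 2 + (B - A) * (-√5) / 10))
      = 5 * (A + B) / (2 * (A ^ 2 + 3 * (A * B) + B ^ 2)) := by
    rw [one_div_mul_one_div, one_div_mul_one_div, div_add_div _ _ (by positivity) (by positivity),
      div_eq_div_iff (by positivity) (by positivity)]
    linear_combination (A + B) * (B - A) ^ 2 / 5 * h5
  rw [heq, div_le_div_iff₀ (by positivity) (by positivity)]
  have hr2 : √(A * B) ^ 2 = A * B := Real.sq_sqrt (by positivity)
  refine le_of_sq_le_sq ?_ (by positivity)
  rw [mul_pow, hr2]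
  -- With `S = (A + B)²` and `P = A B`, the claim is `25 S P ≤ 4 (S + P)²`, that is `0 ≤ (4 S - P)
  -- (S - 4 P)`, where `S - 4 P = (A - B)²`.
  nlinarith [sq_nonneg (A - B), sq_nonneg (A + B), mul_pos hA hB,
    mul_nonneg (mul_pos hA hB).le (sq_nonneg (A - B)), sq_nonneg ((A - B) ^ 2)]

/-- The product of this upper bound and the lower bound of `mean_inv_le_inv_sqrt` is `1 / (A B)`, so
both rest on the same polynomial inequality. -/
lemma inv_sqrt_le_mean_inv {A B : ℝ} (hA : 0 < A) (hB : 0 < B) :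
    1 / √(A * B) ≤ 2 / 5 * (1 / B) + 2 / 5 * (1 / A) + 1 / 5 * (1 / ((A + B) / 2)) := by
  have hr2 : √(A * B) ^ 2 = A * B := Real.sq_sqrt (by positivity)
  have heq : 2 / 5 * (1 / B) + 2 / 5 * (1 / A) + 1 / 5 * (1 / ((A + B) / 2))
      = 2 * ((A + B) ^ 2 + A * B) / (5 * (A * B) * (A + B)) := by
    field_simp
  rw [heq, div_le_div_iff₀ (by positivity) (by positivity)]
  refine le_of_sq_le_sq ?_ (by positivity)
  rw [mul_pow _ √(A * B), hr2]
  nlinarith [mul_nonneg (mul_pos hA hB).le (mul_nonneg (sq_nonneg (A - B)) (sq_nonneg (A - B))),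
    mul_pos hA hB]

/-- Midpoint convexity of the reciprocal. -/
lemma one_div_half_add_le {A B : ℝ} (hA : 0 < A) (hB : 0 < B) :
    1 / ((A + B) / 2) ≤ 1 / 2 * (1 / A) + 1 / 2 * (1 / B) := by
  have heq : 1 / 2 * (1 / A) + 1 / 2 * (1 / B) = (A + B) / (2 * (A * B)) := by
    field_simp; ring
  rw [heq, div_le_div_iff₀ (by positivity) (by positivity)]
  nlinarith [sq_nonneg (A - B)]

theorem theorem18 (x : ℝ) (hx0 : 0 ≤ x) (hx1 : x < 1) :
    lowerL0 x ≤ lowerL1 x ∧ lowerL1 x ≤ lowerL2 x ∧ lowerL2 x ≤ ellipticK x ∧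
      ellipticK x ≤ upperG2 x ∧ upperG2 x ≤ upperG1 x ∧ upperG1 x ≤ upperG0 x := by
  obtain ⟨h2, h3⟩ := sqrt_five_mem
  have h5 : √5 ^ 2 = (5 : ℝ) := Real.sq_sqrt (by norm_num)
  have hp : 0 < (1 + x) / 2 + (1 - x) * √5 / 10 := by nlinarith
  have hm : 0 < (1 + x) / 2 + (1 - x) * (-√5) / 10 := by nlinarith
  have i0 := (ellKernel_integral hx0 hx1 zero_le_one (by linarith)).1
  have i1 := (ellKernel_integral hx0 hx1 (s := (1 + x) / 2) (by positivity) (by positivity)).1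
  have ip := (ellKernel_integral hx0 hx1 hp.le (by linarith)).1
  have im := (ellKernel_integral hx0 hx1 hm.le (by linarith)).1
  obtain ⟨ig, eg⟩ := upperG0_eq hx0 hx1
  have iK := ellipticK_integrable hx0 hx1
  have e0 := lowerL0_eq hx0 hx1
  have e1 := lowerL1_eq hx0 hx1
  have hG2 : upperG2 x = 2 / 5 * lowerL0 x + 2 / 5 * upperG0 x + 1 / 5 * lowerL1 x := by
    rw [upperG2, lowerL1]; ring
  have hker : ∀ s t : ℝ, ellKernel x s t = 1 / √((1 - t) * (1 - x * t)) * (1 / (1 + s * t)) :=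
    fun s t => (one_div_mul_one_div _ _).symm
  have hA : ∀ t ∈ Set.Icc (0 : ℝ) 1, 0 < 1 + x * t := fun t ht => by nlinarith [ht.1]
  have hB : ∀ t ∈ Set.Icc (0 : ℝ) 1, 0 < 1 + 1 * t := fun t ht => by linarith [ht.1]
  have mid : ∀ t : ℝ, 1 + (1 + x) / 2 * t = ((1 + x * t) + (1 + 1 * t)) / 2 := fun t => by ring
  have nod : ∀ t e : ℝ, 1 + ((1 + x) / 2 + (1 - x) * e / 10) * t
      = ((1 + x * t) + (1 + 1 * t)) / 2 + ((1 + 1 * t) - (1 + x * t)) * e / 10 := fun t e => by ring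
  have hL0L1 : lowerL0 x ≤ lowerL1 x := by
    rw [e0, e1]
    refine intervalIntegral.integral_mono_on zero_le_one i0 i1 fun t ht => ?_
    rw [hker, hker]
    have := ht.1
    gcongr
    linarith
  have hL1L2 : lowerL1 x ≤ lowerL2 x := by
    rw [e1, lowerL2_eq hx0 hx1, ← intervalIntegral.integral_const_mul,
      ← intervalIntegral.integral_const_mul, ← intervalIntegral.integral_add
        (ip.const_mul _) (im.const_mul _)]
    refine intervalIntegral.integral_mono_on zero_le_one i1
      ((ip.const_mul _).add (im.const_mul _)) fun t ht => ?_
    have hpt : 0 < 1 + ((1 + x) / 2 + (1 - x) * √5 / 10) * t := by nlinarith [ht.1]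
    have hmt : 0 < 1 + ((1 + x) / 2 + (1 - x) * (-√5) / 10) * t := by nlinarith [ht.1]
    have key : 1 / (1 + (1 + x) / 2 * t)
        ≤ 1 / 2 * (1 / (1 + ((1 + x) / 2 + (1 - x) * √5 / 10) * t))
          + 1 / 2 * (1 / (1 + ((1 + x) / 2 + (1 - x) * (-√5) / 10) * t)) := by
      rw [show 1 + (1 + x) / 2 * t = ((1 + ((1 + x) / 2 + (1 - x) * √5 / 10) * t)
        + (1 + ((1 + x) / 2 + (1 - x) * (-√5) / 10) * t)) / 2 by ring]
      exact one_div_half_add_le hpt hmt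
    simp only [hker]
    have := mul_le_mul_of_nonneg_left key
      (show 0 ≤ 1 / √((1 - t) * (1 - x * t)) by positivity)
    linarith
  have hL2K : lowerL2 x ≤ ellipticK x := by
    rw [lowerL2_eq hx0 hx1, ← intervalIntegral.integral_const_mul,
      ← intervalIntegral.integral_const_mul, ← intervalIntegral.integral_add
        (ip.const_mul _) (im.const_mul _), ellipticK]
    refine intervalIntegral.integral_mono_on zero_le_one
      ((ip.const_mul _).add (im.const_mul _)) iK fun t ht => ?_
    simp only [hker, nod]
    rw [integrand_factor hx0 hx1 ht]
    have := mul_le_mul_of_nonneg_left (mean_inv_le_inv_sqrt (hA t ht) (hB t ht))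
      (show 0 ≤ 1 / √((1 - t) * (1 - x * t)) by positivity)
    rw [mul_comm (1 + x * t), one_mul t] at this
    rw [one_mul t]
    linarith
  have hKG2 : ellipticK x ≤ upperG2 x := by
    rw [hG2, e0, e1, eg, ← intervalIntegral.integral_const_mul,
      ← intervalIntegral.integral_const_mul, ← intervalIntegral.integral_const_mul,
      ← intervalIntegral.integral_add (i0.const_mul _) (ig.const_mul _),
      ← intervalIntegral.integral_add ((i0.const_mul _).add (ig.const_mul _)) (i1.const_mul _),
      ellipticK]
    refine intervalIntegral.integral_mono_on zero_le_one iK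
      (((i0.const_mul _).add (ig.const_mul _)).add (i1.const_mul _)) fun t ht => ?_
    simp only [hker, mid]
    rw [integrand_factor hx0 hx1 ht]
    have := mul_le_mul_of_nonneg_left (inv_sqrt_le_mean_inv (hA t ht) (hB t ht))
      (show 0 ≤ 1 / √((1 - t) * (1 - x * t)) by positivity)
    rw [mul_comm (1 + x * t), one_mul t] at this
    rw [one_mul t]
    linarith
  have hL1G1 : lowerL1 x ≤ 1 / 2 * lowerL0 x + 1 / 2 * upperG0 x := by
    rw [e0, e1, eg, ← intervalIntegral.integral_const_mul,
      ← intervalIntegral.integral_const_mul,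
      ← intervalIntegral.integral_add (i0.const_mul _) (ig.const_mul _)]
    refine intervalIntegral.integral_mono_on zero_le_one i1
      ((i0.const_mul _).add (ig.const_mul _)) fun t ht => ?_
    simp only [hker, mid]
    have := mul_le_mul_of_nonneg_left (one_div_half_add_le (hA t ht) (hB t ht))
      (show 0 ≤ 1 / √((1 - t) * (1 - x * t)) by positivity)
    linarith
  have hL0G0 : lowerL0 x ≤ upperG0 x := by
    rw [e0, eg]
    refine intervalIntegral.integral_mono_on zero_le_one i0 ig fun t ht => ?_
    rw [hker, hker]
    have := ht.1
    gcongr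
  refine ⟨hL0L1, hL1L2, hL2K, hKG2, ?_, ?_⟩
  -- `G₂` is `4/5 G₁ + 1/5 L₁`, so `L₁ ≤ G₁` suffices.
  · rw [hG2, upperG1]; linarith
  · rw [upperG1]; linarith
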